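/- Let $\Bbbk$ be an algebraically closed field, $G$ an affine algebraic group over $\Bbbk$ with algebra of polynomial functions $\Bbbk[G]$, and $H\subseteq G$ a closed subgroup, so that $\Bbbk[H]$ consists of the restrictions to $H$ of the elements of $\Bbbk[G]$. A (not necessarily finite dimensional) rational $G$-module is a linear representation $M$ of $G$ whose action is given by a right $\Bbbk[G]$-comodule structure $\chi(m)=\sum m_0\otimes m_1\in M\otimes\Bbbk[G]$ through $x\cdot m=\sum m_0\,m_1(x)$, and similarly for $H$; ${}^GM$ and ${}^HM$ denote the subspaces of invariants. The group $G$ acts on $\Bbbk[G]$ by $(x\cdot f)(y)=f(yx)$, $H$ acts on $\Bbbk[H]$ by the same formula, and $\Bbbk[G]$ is regarded as an $H$-module by restriction. Then the following three conditions are equivalent: 1. $H$ is strongly observable in $G$: for every rational $H$-module $M$ there are a rational $G$-module $N$ and an injective $H$-equivariant linear map $\iota: M\to N|_H$ with $\iota({}^HM)\subseteq {}^GN$; 2. there is a total integral for $H$ with values in $\Bbbk[G]$: a $\Bbbk$-linear map $\sigma:\Bbbk[H]\to\Bbbk[G]$ with $\sigma(x\cdot f)=x\cdot\sigma(f)$ for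 all $x\in H$, $f\in\Bbbk[H]$, and $\sigma(1)=1$; 3. $\Bbbk[G]$ is an injective object of the category of rational $H$-modules: for every injective morphism $i:X\to Y$ of rational $H$-modules and every morphism $f:X\to\Bbbk[G]$ of $H$-modules there is a morphism $g:Y\to\Bbbk[G]$ of $H$-modules with $g\circ i=f$. -/

import Mathlib

open scoped TensorProduct

universe u v w

/-- The structure of an affine algebraic group over `k` on a group `G` (for `k` algebraically
closed): a finitely generated algebra `coordRing` of `k`-valued functions on `G`, the polynomial
functions, such that the points of `G` are exactly the `k`-algebra maps `coordRing → k` (so `G` is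
an affine variety with this coordinate ring), and such that multiplication and inversion are
morphisms of varieties. -/
structure AffineAlgebraicGroup (k : Type u) (G : Type v) [Field k] [Group G] where
  /-- the algebra `k[G]` of polynomial functions -/
  coordRing : Subalgebra k (G → k)
  fg : coordRing.FG
  eval_bijective : Function.Bijective
    (fun x : G => ((Pi.evalAlgHom k (fun _ : G => k) x).comp coordRing.val : coordRing →ₐ[k] k))
  exists_mul : ∀ f ∈ coordRing, ∃ (n : ℕ) (a b : Fin n → coordRing),
    ∀ x y : G, f (x * y) = ∑ i, (a i : G → k) x * (b i : G → k) y
  inv_mem : ∀ f ∈ coordRing, (fun x => f x⁻¹) ∈ coordRing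

namespace AffineAlgebraicGroup

variable {k : Type u} {G : Type v} [Field k] [Group G]

/-- Evaluation of polynomial functions at the point `x`. -/
def evalAt (𝒢 : AffineAlgebraicGroup k G) (x : G) : 𝒢.coordRing →ₐ[k] k :=
  (Pi.evalAlgHom k (fun _ : G => k) x).comp 𝒢.coordRing.val

/-- A subgroup is closed if it is the zero set of a set of polynomial functions. -/
def IsClosedSubgroup (𝒢 : AffineAlgebraicGroup k G) (H : Subgroup G) : Prop :=
  ∃ S : Set 𝒢.coordRing, ∀ x : G, x ∈ H ↔ ∀ f ∈ S, 𝒢.evalAt x f = 0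

/-- Restriction of functions from `G` to the subgroup `H`. -/
def restrictFun (k : Type u) {G : Type v} [Field k] [Group G] (H : Subgroup G) :
    (G → k) →ₐ[k] (H → k) where
  toFun f := fun x => f x
  map_one' := rfl
  map_mul' _ _ := rfl
  map_zero' := rfl
  map_add' _ _ := rfl
  commutes' _ := rfl

/-- A closed subgroup `H` of `G` is an affine algebraic group, its polynomial functions being the
restrictions to `H` of the polynomial functions on `G`. -/
def closedSubgroup (𝒢 : AffineAlgebraicGroup k G) (H : Subgroup G)
    (hH : 𝒢.IsClosedSubgroup H) : AffineAlgebraicGroup k H where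
  coordRing := 𝒢.coordRing.map (restrictFun k H)
  fg := 𝒢.fg.map _
  eval_bijective := by
    constructor
    · intro x y hxy
      apply Subtype.ext
      apply 𝒢.eval_bijective.1
      ext f
      exact DFunLike.congr_fun hxy
        (⟨restrictFun k H f, Subalgebra.mem_map.2 ⟨f, f.2, rfl⟩⟩ :
          𝒢.coordRing.map (restrictFun k H))
    · intro φ
      let r : 𝒢.coordRing →ₐ[k] 𝒢.coordRing.map (restrictFun k H) :=
        ((restrictFun k H).comp 𝒢.coordRing.val).codRestrict _
          (fun f => Subalgebra.mem_map.2 ⟨f, f.2, rfl⟩)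
      obtain ⟨x, hx⟩ := 𝒢.eval_bijective.2 (φ.comp r)
      obtain ⟨S, hS⟩ := hH
      have hxH : x ∈ H := by
        rw [hS]
        intro f hf
        have h0 : r f = 0 := by
          apply Subtype.ext
          funext y
          exact (hS y).1 y.2 f hf
        have h1 : 𝒢.evalAt x f = φ (r f) := DFunLike.congr_fun hx f
        rw [h1, h0, map_zero]
      refine ⟨⟨x, hxH⟩, ?_⟩
      ext ⟨g, hg⟩
      obtain ⟨f, hf, rfl⟩ := Subalgebra.mem_map.1 hg
      exact DFunLike.congr_fun hx ⟨f, hf⟩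
  exists_mul := by
    intro g hg
    obtain ⟨f, hf, rfl⟩ := Subalgebra.mem_map.1 hg
    obtain ⟨n, a, b, hab⟩ := 𝒢.exists_mul f hf
    exact ⟨n, fun i => ⟨restrictFun k H (a i), Subalgebra.mem_map.2 ⟨a i, (a i).2, rfl⟩⟩,
      fun i => ⟨restrictFun k H (b i), Subalgebra.mem_map.2 ⟨b i, (b i).2, rfl⟩⟩,
      fun x y => hab x y⟩
  inv_mem := by
    intro g hg
    obtain ⟨f, hf, rfl⟩ := Subalgebra.mem_map.1 hg
    exact Subalgebra.mem_map.2 ⟨fun x => f x⁻¹, 𝒢.inv_mem f hf, rfl⟩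

theorem translate_mem (𝒢 : AffineAlgebraicGroup k G) (x : G) (f : 𝒢.coordRing) :
    (fun y => (f : G → k) (y * x)) ∈ 𝒢.coordRing := by
  obtain ⟨n, a, b, hab⟩ := 𝒢.exists_mul f f.2
  have h : (fun y => (f : G → k) (y * x)) = ∑ i, (b i : G → k) x • (a i : G → k) := by
    funext y
    simp [hab, Finset.sum_apply, mul_comm]
  rw [h]
  exact Subalgebra.sum_mem _ fun i _ => Subalgebra.smul_mem _ (a i).2 _

/-- The `G`-module `k[G]`, with the action `(x • f) y = f (y * x)`. -/
def regularRep (𝒢 : AffineAlgebraicGroup k G) : Representation k G 𝒢.coordRing where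
  toFun x :=
    { toFun := fun f => ⟨fun y => (f : G → k) (y * x), 𝒢.translate_mem x f⟩
      map_add' := fun _ _ => rfl
      map_smul' := fun _ _ => rfl }
  map_one' := by
    ext f y
    simp
  map_mul' x x' := by
    ext f y
    simp [mul_assoc]

/-- A `G`-module `M` is rational if its action comes from a coaction `χ : M → M ⊗ k[G]` by the
rule `x • m = ∑ m₀ m₁(x)`. As elements of `M ⊗ k[G]` are determined by their values at the points
of `G`, such a `χ` is unique and automatically coassociative and counital, that is, a right
comodule structure. -/
def IsRational (𝒢 : AffineAlgebraicGroup k G) {M : Type w} [AddCommGroup M] [Module k M]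
    (ρ : Representation k G M) : Prop :=
  ∃ χ : M →ₗ[k] M ⊗[k] 𝒢.coordRing, ∀ (x : G) (m : M),
    ρ x m = TensorProduct.rid k M ((𝒢.evalAt x).toLinearMap.lTensor M (χ m))

/-- The restriction `N|_H` of a `G`-module to a subgroup. -/
def restrictRep {M : Type w} [AddCommGroup M] [Module k M]
    (ρ : Representation k G M) (H : Subgroup G) : Representation k H M :=
  ρ.comp H.subtype

/-- The closed subgroup `H` is strongly observable in `G`: every rational `H`-module `M` embeds
`H`-equivariantly in a rational `G`-module `N` so that `H`-invariants of `M` are sent to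
`G`-invariants of `N`. -/
def StronglyObservable (𝒢 : AffineAlgebraicGroup k G) (H : Subgroup G)
    (hH : 𝒢.IsClosedSubgroup H) : Prop :=
  ∀ (M : Type w) [AddCommGroup M] [Module k M] (ρ : Representation k H M),
    (𝒢.closedSubgroup H hH).IsRational ρ →
    ∃ (N : Type w) (_ : AddCommGroup N) (_ : Module k N) (τ : Representation k G N),
      𝒢.IsRational τ ∧
      ∃ ι : M →ₗ[k] N, Function.Injective ι ∧
        (∀ (x : H) (m : M), ι (ρ x m) = restrictRep τ H x (ι m)) ∧
        ∀ m ∈ ρ.invariants, ι m ∈ τ.invariants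

/-- `σ : k[G] → R` is a total integral with values in the `G`-module algebra `R`: a `k`-linear
`G`-equivariant map with `σ 1 = 1`. -/
def IsTotalIntegral (𝒢 : AffineAlgebraicGroup k G) {R : Type w} [CommRing R] [Algebra k R]
    (ρ : Representation k G R) (σ : 𝒢.coordRing →ₗ[k] R) : Prop :=
  (∀ (x : G) (f : 𝒢.coordRing), σ (𝒢.regularRep x f) = ρ x (σ f)) ∧ σ 1 = 1

/-- The `G`-module `V` is an injective object of the category of rational `G`-modules, tested on
the rational modules of the universe `w`. -/
def IsInjectiveRational (𝒢 : AffineAlgebraicGroup k G) {V : Type*} [AddCommGroup V] [Module k V]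
    (ρ : Representation k G V) : Prop :=
  𝒢.IsRational ρ ∧
  ∀ (X Y : Type w) [AddCommGroup X] [Module k X] [AddCommGroup Y] [Module k Y]
    (ρX : Representation k G X) (ρY : Representation k G Y),
    𝒢.IsRational ρX → 𝒢.IsRational ρY →
    ∀ (i : X →ₗ[k] Y) (f : X →ₗ[k] V), Function.Injective i →
      (∀ (x : G) (m : X), i (ρX x m) = ρY x (i m)) →
      (∀ (x : G) (m : X), f (ρX x m) = ρ x (f m)) →
      ∃ g : Y →ₗ[k] V, (∀ (x : G) (m : Y), g (ρY x m) = ρ x (g m)) ∧ ∀ m : X, g (i m) = f m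

end AffineAlgebraicGroup

/-!
A linear map `φ : Y → V` between rational modules gives, for each `y`, a polynomial map
`x ↦ x⁻¹ • φ (x • y)`, that is, an element of `V ⊗ k[G]`. When `V` is an algebra `R` with a total
integral `σ`, applying `a ⊗ f ↦ a * σ f` averages `φ` to an equivariant map, without changing it
where it was already equivariant. Averaging a linear extension shows that `R` is injective, and
averaging a unital linear section of the restriction `k[G] → k[H]` gives an equivariant unital
section `s`; then `M → M ⊗ k[H] → M ⊗ k[G]`, the coaction followed by `id ⊗ s`, exhibits strong
observability.

Conversely, a total integral is an extension of `k → R` along `k → k[G]` when `R` is injective, and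
it is a matrix coefficient of a strong embedding of `k[H]` when `H` is strongly observable.
-/

namespace AffineAlgebraicGroup

open Representation

variable {k : Type u} {G : Type v} [Field k] [Group G] {𝒢 : AffineAlgebraicGroup k G}

section PolynomialMap

variable {M : Type*} [AddCommGroup M] [Module k M]
variable {M' : Type*} [AddCommGroup M'] [Module k M']

/-- The `M`-valued function on `G` given by an element of `M ⊗ k[G]`. -/
noncomputable def evalMap (𝒢 : AffineAlgebraicGroup k G) (M : Type*) [AddCommGroup M]
    [Module k M] : M ⊗[k] 𝒢.coordRing →ₗ[k] (G → M) :=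
  LinearMap.pi fun x =>
    (TensorProduct.rid k M).toLinearMap ∘ₗ (𝒢.evalAt x).toLinearMap.lTensor M

@[simp]
theorem evalMap_tmul (m : M) (f : 𝒢.coordRing) (x : G) :
    𝒢.evalMap M (m ⊗ₜ f) x = (f : G → k) x • m :=
  rfl

theorem evalMap_rTensor (L : M →ₗ[k] M') (t : M ⊗[k] 𝒢.coordRing) (x : G) :
    𝒢.evalMap M' (L.rTensor _ t) x = L (𝒢.evalMap M t x) := by
  induction t with
  | zero => simp
  | tmul m f => simp
  | add s t hs ht => simp [hs, ht]

theorem evalMap_tprod_regularRep (ρ : Representation k G M) (t : M ⊗[k] 𝒢.coordRing) (x y : G) :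
    𝒢.evalMap M (ρ.tprod 𝒢.regularRep y t) x = ρ y (𝒢.evalMap M t (x * y)) := by
  induction t with
  | zero => simp
  | tmul m f =>
    rw [Representation.tprod_apply, TensorProduct.map_tmul, evalMap_tmul, evalMap_tmul, map_smul]
    rfl
  | add s t hs ht => simp only [map_add, Pi.add_apply, hs, ht]

theorem lid_eq_evalMap (t : k ⊗[k] 𝒢.coordRing) (x : G) :
    (TensorProduct.lid k 𝒢.coordRing t : G → k) x = 𝒢.evalMap k t x := by
  induction t with
  | zero => simp
  | tmul c f => simp [mul_comm]
  | add s t hs ht => simp [hs, ht]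

theorem evalMap_injective : Function.Injective (𝒢.evalMap M) := by
  rw [injective_iff_map_eq_zero]
  intro t ht
  classical
  let b := Module.Basis.ofVectorSpace k M
  apply (TensorProduct.equivFinsuppOfBasisLeft b).injective
  ext i x
  simp [TensorProduct.equivFinsuppOfBasisLeft_apply, lid_eq_evalMap, evalMap_rTensor, ht]

theorem eq_tmul_one_of_evalMap_eq {t : M ⊗[k] 𝒢.coordRing} {m : M}
    (h : ∀ x, 𝒢.evalMap M t x = m) : t = m ⊗ₜ 1 :=
  evalMap_injective <| funext fun x => by simp [h]

/-- A function `G → M` is a polynomial map if it is given by an element of `M ⊗ k[G]`. -/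
def IsPolynomialMap (𝒢 : AffineAlgebraicGroup k G) (F : G → M) : Prop :=
  F ∈ LinearMap.range (𝒢.evalMap M)

namespace IsPolynomialMap

theorem smul_const (f : 𝒢.coordRing) (m : M) :
    𝒢.IsPolynomialMap fun x => (f : G → k) x • m :=
  ⟨m ⊗ₜ f, rfl⟩

theorem add {F F' : G → M} (hF : 𝒢.IsPolynomialMap F) (hF' : 𝒢.IsPolynomialMap F') :
    𝒢.IsPolynomialMap fun x => F x + F' x :=
  Submodule.add_mem _ hF hF'

@[elab_as_elim]
theorem induction {P : ∀ F : G → M, 𝒢.IsPolynomialMap F → Prop}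
    (smul_const : ∀ (f : 𝒢.coordRing) (m : M), P _ (smul_const f m))
    (add : ∀ F F' (hF : 𝒢.IsPolynomialMap F) (hF' : 𝒢.IsPolynomialMap F'),
      P F hF → P F' hF' → P _ (hF.add hF'))
    {F : G → M} (hF : 𝒢.IsPolynomialMap F) : P F hF := by
  obtain ⟨t, rfl⟩ := hF
  induction t with
  | zero => simpa [Pi.zero_def] using smul_const 0 0
  | tmul m f => exact smul_const f m
  | add s t hs ht => simpa [Pi.add_def] using add _ _ _ _ hs ht

theorem map {F : G → M} (hF : 𝒢.IsPolynomialMap F) (L : M →ₗ[k] M') :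
    𝒢.IsPolynomialMap fun x => L (F x) := by
  obtain ⟨t, rfl⟩ := hF
  exact ⟨L.rTensor _ t, funext fun x => evalMap_rTensor L t x⟩

theorem smul {F : G → M} (hF : 𝒢.IsPolynomialMap F) (f : 𝒢.coordRing) :
    𝒢.IsPolynomialMap fun x => (f : G → k) x • F x := by
  induction hF using IsPolynomialMap.induction with
  | smul_const f' m => simpa [mul_smul] using smul_const (f * f') m
  | add F F' _ _ hF hF' => simpa only [smul_add] using hF.add hF'

theorem comp_inv {F : G → M} (hF : 𝒢.IsPolynomialMap F) :
    𝒢.IsPolynomialMap fun x => F x⁻¹ := by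
  induction hF using IsPolynomialMap.induction with
  | smul_const f m => exact smul_const ⟨_, 𝒢.inv_mem f f.2⟩ m
  | add F F' _ _ hF hF' => exact hF.add hF'

end IsPolynomialMap

/-- A linear family of polynomial maps, as a linear map to `M ⊗ k[G]`. -/
noncomputable def polynomialLift (F : G → M' →ₗ[k] M)
    (hF : ∀ y, 𝒢.IsPolynomialMap fun x => F x y) : M' →ₗ[k] M ⊗[k] 𝒢.coordRing :=
  (LinearMap.pi F).codRestrictOfInjective (𝒢.evalMap M) evalMap_injective hF

@[simp]
theorem evalMap_polynomialLift (F : G → M' →ₗ[k] M)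
    (hF : ∀ y, 𝒢.IsPolynomialMap fun x => F x y) (y : M') (x : G) :
    𝒢.evalMap M (polynomialLift F hF y) x = F x y :=
  congrFun ((LinearMap.pi F).codRestrictOfInjective_comp_apply _ _ hF y) x

end PolynomialMap

section Restriction

/-- The restriction `k[G] → k[H]` of polynomial functions. -/
def restrictCoord (𝒢 : AffineAlgebraicGroup k G) (H : Subgroup G) (hH : 𝒢.IsClosedSubgroup H) :
    𝒢.coordRing →ₐ[k] (𝒢.closedSubgroup H hH).coordRing :=
  ((restrictFun k H).comp 𝒢.coordRing.val).codRestrict _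
    fun f => Subalgebra.mem_map.2 ⟨f, f.2, rfl⟩

variable {H : Subgroup G} {hH : 𝒢.IsClosedSubgroup H}

theorem restrictCoord_surjective : Function.Surjective (𝒢.restrictCoord H hH) := by
  rintro ⟨_, hg⟩
  obtain ⟨f, hf, rfl⟩ := Subalgebra.mem_map.1 hg
  exact ⟨⟨f, hf⟩, rfl⟩

theorem restrictCoord_regularRep (x : H) (f : 𝒢.coordRing) :
    𝒢.restrictCoord H hH (restrictRep 𝒢.regularRep H x f) =
      (𝒢.closedSubgroup H hH).regularRep x (𝒢.restrictCoord H hH f) :=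
  rfl

theorem IsPolynomialMap.restrict {M : Type*} [AddCommGroup M] [Module k M] {F : G → M}
    (hF : 𝒢.IsPolynomialMap F) :
    (𝒢.closedSubgroup H hH).IsPolynomialMap fun x : H => F x := by
  induction hF using IsPolynomialMap.induction with
  | smul_const f m => exact smul_const (𝒢.restrictCoord H hH f) m
  | add F F' _ _ hF hF' => exact hF.add hF'

end Restriction

section Rational

variable {M : Type*} [AddCommGroup M] [Module k M] {ρ : Representation k G M}
variable {M' : Type*} [AddCommGroup M'] [Module k M'] {ρ' : Representation k G M'}

theorem isRational_iff : 𝒢.IsRational ρ ↔ ∀ m, 𝒢.IsPolynomialMap fun x => ρ x m := by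
  refine ⟨fun ⟨χ, hχ⟩ m => ⟨χ m, funext fun x => (hχ x m).symm⟩, fun h => ?_⟩
  exact ⟨polynomialLift ρ h, fun x m => (evalMap_polynomialLift ρ h m x).symm⟩

theorem IsRational.isPolynomialMap_apply (hρ : 𝒢.IsRational ρ) {F : G → M}
    (hF : 𝒢.IsPolynomialMap F) : 𝒢.IsPolynomialMap fun x => ρ x (F x) := by
  induction hF using IsPolynomialMap.induction with
  | smul_const f m => simpa only [map_smul] using (isRational_iff.1 hρ m).smul f
  | add F F' _ _ hF hF' => simpa only [map_add] using hF.add hF'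

theorem IsRational.of_surjective (hρ : 𝒢.IsRational ρ) (f : IntertwiningMap ρ ρ')
    (hf : Function.Surjective f) : 𝒢.IsRational ρ' := by
  refine isRational_iff.2 fun m' => ?_
  obtain ⟨m, rfl⟩ := hf m'
  simpa only [← f.isIntertwining] using! (isRational_iff.1 hρ m).map f.toLinearMap

theorem IsRational.tprod (hρ : 𝒢.IsRational ρ) (hρ' : 𝒢.IsRational ρ') :
    𝒢.IsRational (ρ.tprod ρ') := by
  refine isRational_iff.2 fun t => ?_
  induction t with
  | zero => exact ⟨0, by ext; simp⟩
  | tmul m m' =>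
    have tmul_orbit {F : G → M} (hF : 𝒢.IsPolynomialMap F) :
        𝒢.IsPolynomialMap fun x => F x ⊗ₜ[k] ρ' x m' := by
      induction hF using IsPolynomialMap.induction with
      | smul_const f n =>
        exact ((isRational_iff.1 hρ' m').map (TensorProduct.mk k M M' n)).smul f
      | add F F' _ _ hF hF' => simpa only [TensorProduct.add_tmul] using hF.add hF'
    exact tmul_orbit (isRational_iff.1 hρ m)
  | add s t hs ht => simpa only [map_add] using hs.add ht

theorem IsRational.restrict (hρ : 𝒢.IsRational ρ) {H : Subgroup G}
    (hH : 𝒢.IsClosedSubgroup H) : (𝒢.closedSubgroup H hH).IsRational (restrictRep ρ H) :=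
  isRational_iff.2 fun m => (isRational_iff.1 hρ m).restrict

theorem isRational_trivial : 𝒢.IsRational (trivial k G M) :=
  isRational_iff.2 fun m => ⟨m ⊗ₜ 1, by ext; simp⟩

theorem isRational_regularRep : 𝒢.IsRational 𝒢.regularRep := by
  refine isRational_iff.2 fun f => ?_
  obtain ⟨n, a, b, hab⟩ := 𝒢.exists_mul f f.2
  refine ⟨∑ i, a i ⊗ₜ b i, ?_⟩
  ext x y
  simpa [regularRep, mul_comm] using (hab y x).symm

end Rational

section OrbitMap

variable {M : Type*} [AddCommGroup M] [Module k M] {ρ : Representation k G M}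
variable {Y : Type*} [AddCommGroup Y] [Module k Y] {τ : Representation k G Y}

theorem isPolynomialMap_inv_apply_apply (hτ : 𝒢.IsRational τ) (hρ : 𝒢.IsRational ρ)
    (φ : Y →ₗ[k] M) (y : Y) : 𝒢.IsPolynomialMap fun x => (ρ x⁻¹ ∘ₗ φ ∘ₗ τ x) y := by
  have orbit_inv : 𝒢.IsPolynomialMap fun x => φ (τ x⁻¹ y) :=
    ((isRational_iff.1 hτ y).map φ).comp_inv
  simpa only [inv_inv, LinearMap.comp_apply] using (hρ.isPolynomialMap_apply orbit_inv).comp_inv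

/-- The map `Y → M ⊗ k[G]` sending `y` to the polynomial map `x ↦ x⁻¹ • φ (x • y)`, the orbit of
`φ` under conjugation evaluated at `y`. When `G` acts trivially on `M = Y` and `φ` is the identity
it is the coaction of `τ`. -/
noncomputable def orbitMap (hτ : 𝒢.IsRational τ) (hρ : 𝒢.IsRational ρ) (φ : Y →ₗ[k] M) :
    IntertwiningMap τ (ρ.tprod 𝒢.regularRep) where
  toLinearMap := polynomialLift (fun x => ρ x⁻¹ ∘ₗ φ ∘ₗ τ x)
    (isPolynomialMap_inv_apply_apply hτ hρ φ)
  isIntertwining' z := by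
    ext y : 1
    apply evalMap_injective
    ext x
    simp [evalMap_tprod_regularRep, -Representation.tprod_apply]

variable (hτ : 𝒢.IsRational τ) (hρ : 𝒢.IsRational ρ)

theorem evalMap_orbitMap (φ : Y →ₗ[k] M) (y : Y) (x : G) :
    𝒢.evalMap M (orbitMap hτ hρ φ y) x = ρ x⁻¹ (φ (τ x y)) :=
  evalMap_polynomialLift _ (isPolynomialMap_inv_apply_apply hτ hρ φ) y x

/-- The comodule structure `χ : M → M ⊗ k[G]` of a rational module. -/
noncomputable def coaction : IntertwiningMap ρ ((trivial k G M).tprod 𝒢.regularRep) :=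
  orbitMap hρ isRational_trivial LinearMap.id

theorem evalMap_coaction (m : M) (x : G) : 𝒢.evalMap M (coaction hρ m) x = ρ x m :=
  evalMap_orbitMap hρ isRational_trivial LinearMap.id m x

theorem coaction_injective : Function.Injective (coaction hρ) := by
  intro m m' h
  simpa [evalMap_coaction] using congrArg (fun t => 𝒢.evalMap M t 1) h

theorem coaction_of_mem_invariants {m : M} (hm : m ∈ ρ.invariants) :
    coaction hρ m = m ⊗ₜ 1 :=
  eq_tmul_one_of_evalMap_eq fun x => (evalMap_coaction hρ m x).trans (hm x)

/-- The polynomial functions `x ↦ l (x • y)` on `G`. -/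
noncomputable def matrixCoefficient (l : Module.Dual k Y) : IntertwiningMap τ 𝒢.regularRep :=
  (Representation.TensorProduct.lid k 𝒢.regularRep).toIntertwiningMap.comp
    (orbitMap hτ isRational_trivial l)

theorem matrixCoefficient_apply (l : Module.Dual k Y) (y : Y) (x : G) :
    (matrixCoefficient hτ l y : G → k) x = l (τ x y) :=
  (lid_eq_evalMap _ x).trans (evalMap_orbitMap hτ isRational_trivial l y x)

end OrbitMap

section TotalIntegral

variable {R : Type*} [CommRing R] [Algebra k R] {ρ : Representation k G R}
variable {R' : Type*} [Ring R'] [Algebra k R']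
variable {Y : Type*} [AddCommGroup Y] [Module k Y] {τ : Representation k G Y}

namespace IsTotalIntegral

variable {σ : 𝒢.coordRing →ₗ[k] R}

theorem apply_one (hσ : 𝒢.IsTotalIntegral ρ σ) (x : G) : ρ x 1 = 1 :=
  calc
    ρ x 1 = σ (𝒢.regularRep x 1) := by rw [hσ.1, hσ.2]
    _ = 1 := hσ.2

variable (hσ : 𝒢.IsTotalIntegral ρ σ) (hmul : ∀ x a b, ρ x (a * b) = ρ x a * ρ x b)

/-- The integral `R ⊗ k[G] → R`, `a ⊗ f ↦ a * σ f`, of `R`-valued polynomial maps. -/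
noncomputable def integrate : IntertwiningMap (ρ.tprod 𝒢.regularRep) ρ where
  toLinearMap := LinearMap.mul' k R ∘ₗ σ.lTensor R
  isIntertwining' x := by
    ext a f
    simp [hσ.1, hmul]

theorem map_integrate (π : R →ₐ[k] R') (t : R ⊗[k] 𝒢.coordRing) :
    π (hσ.integrate hmul t) =
      LinearMap.mul' k R' ((π.toLinearMap ∘ₗ σ).lTensor R' (π.toLinearMap.rTensor _ t)) := by
  induction t with
  | zero => simp
  | tmul a f => simp [integrate]
  | add s t hs ht => simp only [map_add, hs, ht]

variable (hτ : 𝒢.IsRational τ) (hρ : 𝒢.IsRational ρ)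

/-- The average of a linear map `φ : Y → R` over its conjugates by `G`, with respect to the total
integral `σ`. -/
noncomputable def average (φ : Y →ₗ[k] R) : IntertwiningMap τ ρ :=
  (hσ.integrate hmul).comp (orbitMap hτ hρ φ)

theorem map_average (π : R →ₐ[k] R') {φ : Y →ₗ[k] R} {y : Y}
    (h : ∀ x, π (ρ x⁻¹ (φ (τ x y))) = π (φ y)) : π (hσ.average hmul hτ hρ φ y) = π (φ y) := by
  have orbit_const : π.toLinearMap.rTensor _ (orbitMap hτ hρ φ y) = π (φ y) ⊗ₜ 1 :=
    eq_tmul_one_of_evalMap_eq fun x => by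
      rw [evalMap_rTensor, evalMap_orbitMap]
      exact h x
  rw [average, IntertwiningMap.comp_apply, map_integrate, orbit_const]
  simp [hσ.2]

theorem average_eq {φ : Y →ₗ[k] R} {y : Y} (h : ∀ x, φ (τ x y) = ρ x (φ y)) :
    hσ.average hmul hτ hρ φ y = φ y :=
  hσ.map_average hmul hτ hρ (AlgHom.id k R) fun x => by simp [h]

end IsTotalIntegral

theorem exists_linear_section_apply_eq {V W : Type*} [AddCommGroup V] [Module k V]
    [AddCommGroup W] [Module k W] (π : V →ₗ[k] W) (hπ : Function.Surjective π) {v : V}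
    (hv : π v ≠ 0) : ∃ φ : W →ₗ[k] V, (∀ w, π (φ w) = w) ∧ φ (π v) = v := by
  obtain ⟨φ, hφ⟩ := π.exists_rightInverse_of_surjective (LinearMap.range_eq_top.2 hπ)
  replace hφ (w : W) : π (φ w) = w := LinearMap.congr_fun hφ w
  obtain ⟨l, hl⟩ := Module.Projective.exists_dual_eq_one k hv
  exact ⟨φ + l.smulRight (v - φ (π v)), fun w => by simp [hφ], by simp [hl]⟩

theorem IsTotalIntegral.exists_equivariant_section [Nontrivial R'] {ρ' : Representation k G R'}
    {σ : 𝒢.coordRing →ₗ[k] R} (hσ : 𝒢.IsTotalIntegral ρ σ) (hρ : 𝒢.IsRational ρ)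
    (hmul : ∀ x a b, ρ x (a * b) = ρ x a * ρ x b) (π : R →ₐ[k] R')
    (hπ : Function.Surjective π) (hπρ : ∀ x a, π (ρ x a) = ρ' x (π a)) :
    ∃ s : IntertwiningMap ρ' ρ, (∀ b, π (s b) = b) ∧ s 1 = 1 := by
  have hρ' : 𝒢.IsRational ρ' :=
    hρ.of_surjective ⟨π.toLinearMap, fun x => LinearMap.ext (hπρ x)⟩ hπ
  have hρ'_one (x : G) : ρ' x 1 = 1 := by rw [← map_one π, ← hπρ, hσ.apply_one]
  obtain ⟨φ, hφ, hφ_one⟩ : ∃ φ : R' →ₗ[k] R, (∀ b, π (φ b) = b) ∧ φ 1 = 1 := by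
    simpa using exists_linear_section_apply_eq π.toLinearMap hπ (v := 1) (by simp)
  refine ⟨hσ.average hmul hρ' hρ φ, fun b => ?_, ?_⟩
  · rw [hσ.map_average hmul hρ' hρ π fun x => ?_, hφ]
    rw [hπρ, hφ, hφ, inv_self_apply]
  · rw [hσ.average_eq hmul hρ' hρ fun x => ?_, hφ_one]
    rw [hρ'_one, hφ_one, hσ.apply_one]

theorem IsTotalIntegral.isInjectiveRational {σ : 𝒢.coordRing →ₗ[k] R}
    (hσ : 𝒢.IsTotalIntegral ρ σ) (hρ : 𝒢.IsRational ρ)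
    (hmul : ∀ x a b, ρ x (a * b) = ρ x a * ρ x b) : IsInjectiveRational.{u, v, w} 𝒢 ρ := by
  refine ⟨hρ, fun X Y _ _ _ _ ρX ρY _ hY i f hi hi_equiv hf_equiv => ?_⟩
  obtain ⟨p, hp⟩ := i.exists_leftInverse_of_injective (LinearMap.ker_eq_bot.2 hi)
  replace hp (m : X) : p (i m) = m := LinearMap.congr_fun hp m
  let g := hσ.average hmul hY hρ (f ∘ₗ p)
  refine ⟨g.toLinearMap, g.isIntertwining, fun m => ?_⟩
  calc
    g (i m) = f (p (i m)) := hσ.average_eq hmul hY hρ fun x => by simp [← hi_equiv, hp, hf_equiv]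
    _ = f m := by rw [hp]

end TotalIntegral

section ULift

variable {M : Type*} [AddCommGroup M] [Module k M]

/-- The representation `ρ` on a copy of its space in a larger universe. -/
def uliftRep (ρ : Representation k G M) : Representation k G (ULift.{w} M) :=
  (ULift.moduleEquiv (R := k) (M := M)).symm.conjRingEquiv.toMonoidHom.comp ρ

/-- The isomorphism between a representation and its copy in a larger universe. -/
def uliftEquiv (ρ : Representation k G M) : (uliftRep.{u, v, w} ρ).Equiv ρ :=
  .mk ULift.moduleEquiv fun _ => rfl

theorem IsRational.ulift {ρ : Representation k G M} (hρ : 𝒢.IsRational ρ) :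
    𝒢.IsRational (uliftRep.{u, v, w} ρ) :=
  hρ.of_surjective (uliftEquiv ρ).symm.toIntertwiningMap
    (uliftEquiv ρ).symm.toLinearEquiv.surjective

end ULift

theorem IsInjectiveRational.exists_isTotalIntegral {R : Type*} [CommRing R] [Algebra k R]
    {ρ : Representation k G R} (h : IsInjectiveRational.{u, v, max u v w} 𝒢 ρ)
    (hone : ∀ x, ρ x 1 = 1) : ∃ σ, 𝒢.IsTotalIntegral ρ σ := by
  let d : ULift.{max v w} k ≃ₗ[k] k := ULift.moduleEquiv
  let e := (uliftEquiv.{u, v, w} 𝒢.regularRep).symm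
  obtain ⟨g, hg, hg_extends⟩ := h.2 _ _ (trivial k G (ULift.{max v w} k)) (uliftRep 𝒢.regularRep)
    isRational_trivial isRational_regularRep.ulift
    (e.toLinearMap ∘ₗ Algebra.linearMap k 𝒢.coordRing ∘ₗ d.toLinearMap)
    (Algebra.linearMap k R ∘ₗ d.toLinearMap)
    (e.toLinearEquiv.injective.comp ((algebraMap k 𝒢.coordRing).injective.comp d.injective))
    (fun _ _ => rfl) (fun x c => by simp [Algebra.algebraMap_eq_smul_one, hone])
  refine ⟨g ∘ₗ e.toLinearMap, fun x f => ?_, ?_⟩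
  · exact (congrArg g (e.toIntertwiningMap.isIntertwining _ _ x f)).trans (hg x (e f))
  · simpa using hg_extends (d.symm 1)

section StronglyObservable

variable {H : Subgroup G} {hH : 𝒢.IsClosedSubgroup H}

theorem stronglyObservable_of_injective
    (s : IntertwiningMap (𝒢.closedSubgroup H hH).regularRep (restrictRep 𝒢.regularRep H))
    (hs : Function.Injective s) (hs_one : s 1 = 1) :
    StronglyObservable.{u, v, max u v w} 𝒢 H hH := by
  intro M _ _ ρ hρ
  let ι := (s.lTensor (trivial k H M)).comp (coaction hρ)
  refine ⟨M ⊗[k] 𝒢.coordRing, inferInstance, inferInstance,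
    (trivial k G M).tprod 𝒢.regularRep, isRational_trivial.tprod isRational_regularRep,
    ι.toLinearMap, ?_, ι.isIntertwining, fun m hm x => ?_⟩
  · exact (Module.Flat.lTensor_preserves_injective_linearMap s.toLinearMap hs).comp
      (coaction_injective hρ)
  · have ι_m : ι m = m ⊗ₜ 1 := by
      simp [ι, coaction_of_mem_invariants hρ hm, hs_one]
    rw [IntertwiningMap.toLinearMap_apply, ι_m]
    rfl

theorem StronglyObservable.exists_isTotalIntegral
    (h : StronglyObservable.{u, v, max u v w} 𝒢 H hH) :
    ∃ σ, (𝒢.closedSubgroup H hH).IsTotalIntegral (restrictRep 𝒢.regularRep H) σ := by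
  let e := (uliftEquiv.{u, v, w} (𝒢.closedSubgroup H hH).regularRep).symm
  obtain ⟨N, _, _, τ, hτ, ι, hι, hι_equiv, hι_inv⟩ := h _ _ isRational_regularRep.ulift
  have hι_one : ι (e 1) ∈ τ.invariants := hι_inv _ fun x => rfl
  have hι_ne : ι (e 1) ≠ 0 := by
    rw [map_ne_zero_iff ι hι]
    exact e.toLinearEquiv.map_ne_zero_iff.2 one_ne_zero
  obtain ⟨l, hl⟩ := Module.Projective.exists_dual_eq_one k hι_ne
  refine ⟨(matrixCoefficient hτ l).toLinearMap ∘ₗ ι ∘ₗ e.toLinearMap, fun x f => ?_, ?_⟩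
  · have ι_equiv : ι (e ((𝒢.closedSubgroup H hH).regularRep x f)) = τ x (ι (e f)) :=
      (congrArg ι (e.toIntertwiningMap.isIntertwining _ _ x f)).trans (hι_equiv x (e f))
    exact (congrArg _ ι_equiv).trans ((matrixCoefficient hτ l).isIntertwining _ _ x (ι (e f)))
  · ext x
    simp [matrixCoefficient_apply, hι_one x, hl]

end StronglyObservable

end AffineAlgebraicGroup

open AffineAlgebraicGroup in
theorem theorem4p3_general {k : Type u} {G : Type v} [Field k] [Group G]
    (𝒢 : AffineAlgebraicGroup k G) (H : Subgroup G) (hH : 𝒢.IsClosedSubgroup H) :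
    List.TFAE [StronglyObservable.{u, v, max u v w} 𝒢 H hH,
      ∃ σ, (𝒢.closedSubgroup H hH).IsTotalIntegral (restrictRep 𝒢.regularRep H) σ,
      IsInjectiveRational.{u, v, max u v w} (𝒢.closedSubgroup H hH)
        (restrictRep 𝒢.regularRep H)] := by
  have hR : (𝒢.closedSubgroup H hH).IsRational (restrictRep 𝒢.regularRep H) :=
    isRational_regularRep.restrict hH
  tfae_have 1 → 2 := StronglyObservable.exists_isTotalIntegral
  tfae_have 2 → 1 := by
    rintro ⟨σ, hσ⟩
    obtain ⟨s, hs, hs_one⟩ := hσ.exists_equivariant_section hR (fun _ _ _ => rfl)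
      (𝒢.restrictCoord H hH) restrictCoord_surjective restrictCoord_regularRep
    exact stronglyObservable_of_injective s (Function.LeftInverse.injective hs) hs_one
  tfae_have 2 → 3 := fun ⟨_, hσ⟩ => hσ.isInjectiveRational hR fun _ _ _ => rfl
  tfae_have 3 → 2 := fun h => h.exists_isTotalIntegral fun _ => rfl
  tfae_finish

theorem theorem4p3 {k : Type u} {G : Type v} [Field k] [IsAlgClosed k] [Group G]
    (𝒢 : AffineAlgebraicGroup k G) (H : Subgroup G) (hH : 𝒢.IsClosedSubgroup H) :
    (AffineAlgebraicGroup.StronglyObservable.{u, v, max u v w} 𝒢 H hH ↔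
      ∃ σ : (𝒢.closedSubgroup H hH).coordRing →ₗ[k] 𝒢.coordRing,
        (𝒢.closedSubgroup H hH).IsTotalIntegral
          (AffineAlgebraicGroup.restrictRep 𝒢.regularRep H) σ) ∧
    ((∃ σ : (𝒢.closedSubgroup H hH).coordRing →ₗ[k] 𝒢.coordRing,
        (𝒢.closedSubgroup H hH).IsTotalIntegral
          (AffineAlgebraicGroup.restrictRep 𝒢.regularRep H) σ) ↔
      AffineAlgebraicGroup.IsInjectiveRational.{u, v, max u v w} (𝒢.closedSubgroup H hH)
        (AffineAlgebraicGroup.restrictRep 𝒢.regularRep H)) := by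
  have h := theorem4p3_general.{u, v, w} 𝒢 H hH
  exact ⟨h.out 0 1, h.out 1 2⟩
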